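/- Call a set $K$ in a topological space saturated if it is the intersection of its open neighbourhoods, and write $x\le y$ iff $x\in \mathrm{cl}\{y\}$ (specialization order); $\mathord{\downarrow}$, directed sets (always nonempty) and suprema refer to this order. A family $\mathfrak K$ of compact saturated sets is filtered if it is nonempty and any two members contain a third. A nonempty set $A$ is a $KF$-set if there is a filtered family $\mathfrak K$ of compact saturated sets such that $\mathrm{cl}(A)$ is minimal among the closed sets that meet all members of $\mathfrak K$. A $T_0$ space is a monotone convergence space if the closure of every directed set is the closure of a unique point, and it is well-filtered if for every filtered family $\mathfrak K$ of compact saturated sets and every open $U\supseteq\bigcap\mathfrak K$ some $K\in\mathfrak K$ satisfies $K\subseteq U$. A $D$-completion of a $T_0$ space $X$ is a topological embedding $j\colon X\to Y$ into a monotone convergence space $Y$ such that the smallest subset of $Y$ that contains $j(X)$ and is closed under suprema of directed subsets is $Y$. A well-filterification of $X$ is a reflection of $X$ in the category of well-filtered $T_0$ spaces: a continuous map $\eta\colon X\to W$ to a well-filtered $T_0$ space through which every continuous map from $X$ to a well-filtered $T_0$ space factors uniquely and continuously. Let $Z=\{(y,n) : y,n\in\mathbb N\}$, where $U\subseteq Z$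 is open iff for every $n$ the set $\{y\mid (y,n)\in U\}$ is Scott open in $\mathbb N$, and the set $\{n\mid \exists y,\ (y,n)\in U\}$ is open in the cofinite topology of $\mathbb N$ (that is, $Z$ is the Ershov sum $\sum_{(\mathbb N,\tau_{cof})}(\mathbb N,\sigma(\mathbb N))$). Then $Z$ is a $T_0$ space with the following properties. 1. For every closed $KF$-set $A$ and every compact saturated set $K$ of $Z$, the set $\mathord{\downarrow}(K\cap A)$ is closed in $Z$. 2. $Z$ has a $D$-completion and a well-filterification, and no $D$-completion $Z^d$ of $Z$ is homeomorphic to a well-filterification $Z^w$ of $Z$. Hence the $D$-completion of a $T_0$ space $X$ in which $\mathord{\downarrow}(K\cap A)$ is closed for all closed $KF$-sets $A$ and all compact saturated sets $K$ need not coincide with the well-filterification of $X$. -/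

import Mathlib

open Topology

universe u v

namespace NonHausdorff

section Basic

variable {X : Type u} [TopologicalSpace X]

/-- The specialization order: `x ≤ y` iff `x ∈ cl {y}`. -/
def SpecLE (x y : X) : Prop := x ∈ closure ({y} : Set X)

/-- The down-closure of `A` in the specialization order. -/
def down (A : Set X) : Set X := {x | ∃ a ∈ A, SpecLE x a}

/-- A directed subset (nonempty) in the specialization order. -/
def IsDirectedSet (D : Set X) : Prop := D.Nonempty ∧ DirectedOn SpecLE D

/-- `s` is the supremum of `D` in the specialization order. -/
def IsSup (D : Set X) (s : X) : Prop :=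
  (∀ d ∈ D, SpecLE d s) ∧ ∀ t, (∀ d ∈ D, SpecLE d t) → SpecLE s t

/-- A saturated set is the intersection of its open neighbourhoods. -/
def IsSaturated (K : Set X) : Prop := K = ⋂₀ {U : Set X | IsOpen U ∧ K ⊆ U}

/-- The compact saturated sets, `Q(X)`. -/
def IsCompactSaturated (K : Set X) : Prop := IsCompact K ∧ IsSaturated K

/-- A filtered family (filter basis) of compact saturated sets. -/
def IsFilteredFamily (𝒦 : Set (Set X)) : Prop :=
  𝒦.Nonempty ∧ (∀ K ∈ 𝒦, IsCompactSaturated K) ∧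
    ∀ K₁ ∈ 𝒦, ∀ K₂ ∈ 𝒦, ∃ K ∈ 𝒦, K ⊆ K₁ ∩ K₂

/-- `A` is a `KF`-set: it is nonempty and, for some filtered family of compact saturated sets,
`cl A` is minimal among the closed sets that meet every member of the family. -/
def IsKF (A : Set X) : Prop :=
  A.Nonempty ∧ ∃ 𝒦 : Set (Set X), IsFilteredFamily 𝒦 ∧
    Minimal (fun C : Set X => IsClosed C ∧ ∀ K ∈ 𝒦, (C ∩ K).Nonempty) (closure A)

/-- A set closed under those suprema of its directed subsets that exist in `X`. -/
def IsDClosed (A : Set X) : Prop :=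
  ∀ D : Set X, D ⊆ A → IsDirectedSet D → ∀ s, IsSup D s → s ∈ A

/-- The `d`-closure: the smallest `d`-closed set containing `A`. -/
def dClosure (A : Set X) : Set X := ⋂₀ {C : Set X | IsDClosed C ∧ A ⊆ C}

end Basic

/-- Monotone convergence spaces. -/
def IsMonotoneConvergence (X : Type u) [TopologicalSpace X] : Prop :=
  T0Space X ∧ ∀ D : Set X, IsDirectedSet D → ∃! x : X, closure D = closure {x}

/-- Well-filtered `T₀` spaces. -/
def IsWellFiltered (X : Type u) [TopologicalSpace X] : Prop :=
  T0Space X ∧ ∀ 𝒦 : Set (Set X), IsFilteredFamily 𝒦 →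
    ∀ U : Set X, IsOpen U → ⋂₀ 𝒦 ⊆ U → ∃ K ∈ 𝒦, K ⊆ U

/-- `j : X → Y` is a `D`-completion of `X`. -/
def IsDCompletion {X : Type u} {Y : Type v} [TopologicalSpace X] [TopologicalSpace Y]
    (j : X → Y) : Prop :=
  IsMonotoneConvergence Y ∧ IsEmbedding j ∧ dClosure (Set.range j) = Set.univ

/-- `η : X → W` is a well-filterification of `X`, that is, a reflection of `X` in the category of
well-filtered `T₀` spaces and continuous maps. -/
def IsWellFilterification {X : Type u} {W : Type v} [TopologicalSpace X] [TopologicalSpace W]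
    (η : X → W) : Prop :=
  IsWellFiltered W ∧ Continuous η ∧
    ∀ (T : Type v) [TopologicalSpace T], IsWellFiltered T → ∀ f : X → T, Continuous f →
      ∃! g : W → T, Continuous g ∧ g ∘ η = f

/-- The underlying set of the Ershov sum: the pairs `(y, x)` with `x ∈ X` and `y ∈ Y x`. -/
structure ErshovSum {X : Type u} (Y : X → Type v) where
  base : X
  fiber : Y base

namespace ErshovSum

variable {X : Type u} {Y : X → Type v}

/-- The section `(A)_x`. -/
def section_ (A : Set (ErshovSum Y)) (x : X) : Set (Y x) := {y | ⟨x, y⟩ ∈ A}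

/-- The projection `(A)_X`, the set of those `x` for which `(A)_x` is nonempty. -/
def support (A : Set (ErshovSum Y)) : Set X := {x | (section_ A x).Nonempty}

/-- The topology of the Ershov sum of irreducible spaces: `U` is open iff all its sections
`(U)_x` and its projection `(U)_X` are open. -/
instance [TopologicalSpace X] [∀ x, TopologicalSpace (Y x)] [∀ x, IrreducibleSpace (Y x)] :
    TopologicalSpace (ErshovSum Y) where
  IsOpen U := (∀ x, IsOpen (section_ U x)) ∧ IsOpen (support U)
  isOpen_univ := by
    refine ⟨fun x => isOpen_univ, ?_⟩
    have h : support (Set.univ : Set (ErshovSum Y)) = Set.univ :=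
      Set.eq_univ_of_forall fun x => (inferInstance : Nonempty (Y x)).elim fun y => ⟨y, trivial⟩
    rw [h]
    exact isOpen_univ
  isOpen_inter U V hU hV := by
    refine ⟨fun x => (hU.1 x).inter (hV.1 x), ?_⟩
    have h : support (U ∩ V) = support U ∩ support V := by
      ext x
      constructor
      · rintro ⟨y, hy⟩
        exact ⟨⟨y, hy.1⟩, ⟨y, hy.2⟩⟩
      · rintro ⟨h₁, h₂⟩
        exact nonempty_preirreducible_inter (hU.1 x) (hV.1 x) h₁ h₂
    rw [h]
    exact hU.2.inter hV.2
  isOpen_sUnion S hS := by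
    constructor
    · intro x
      have h : section_ (⋃₀ S) x = ⋃ U ∈ S, section_ U x := by
        ext y
        simp [section_]
      rw [h]
      exact isOpen_biUnion fun U hU => (hS U hU).1 x
    · have h : support (⋃₀ S) = ⋃ U ∈ S, support U := by
        ext x
        simp only [support, section_, Set.Nonempty, Set.mem_ofPred_eq, Set.mem_sUnion,
          Set.mem_iUnion, exists_prop]
        constructor
        · rintro ⟨y, U, hU, hy⟩
          exact ⟨U, hU, y, hy⟩
        · rintro ⟨U, hU, y, hy⟩
          exact ⟨y, U, hU, hy⟩
      rw [h]
      exact isOpen_biUnion fun U hU => (hS U hU).2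

end ErshovSum

/-- The natural numbers with the Scott topology form an irreducible space. -/
instance : IrreducibleSpace (WithScott ℕ) where
  isPreirreducible_univ := by
    rintro U V hU hV ⟨a, -, ha⟩ ⟨b, -, hb⟩
    have hU' := IsScott.isUpperSet_of_isOpen (D := Set.univ) hU
    have hV' := IsScott.isUpperSet_of_isOpen (D := Set.univ) hV
    rcases Nat.le_total a b with h | h
    · exact ⟨b, trivial, hU' (a := a) (b := b) h ha, hb⟩
    · exact ⟨a, trivial, ha, hV' (a := b) (b := a) h hb⟩
  toNonempty := ⟨WithScott.toScott 0⟩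

/-- The Ershov sum `Z`, over `ℕ` with the cofinite topology, of copies of `ℕ` with the Scott
topology. -/
abbrev Z : Type := ErshovSum (fun _ : CofiniteTopology ℕ => WithScott ℕ)

end NonHausdorff

/-! A nonempty open set of `Z` meets all but finitely many columns, so the irreducible closed sets
are `Z` itself and the nonempty lower sets inside one column (`eq_univ_or_subset_column`). A compact
set meets only finitely many columns, so minimality confines a closed `KF`-set to finitely many
columns, where every lower set is closed (`isClosed_down_inter`).

A `D`-completion gives each column a supremum `s n`, and every point lies below exactly one of
these. The map `s` is continuous on the cofinite base, so the saturations of the images of cofinite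
sets form a filtered family of compact saturated sets. Its intersection is empty, hence no
`D`-completion is well-filtered (`not_isWellFiltered_of_isDCompletion`). In a well-filtered target
the same family yields a generic point for the image of all of `Z`
(`closure_image_eq_of_isWellFiltered`), so the sobrification is the well-filterification. -/

namespace NonHausdorff

open Set

/-! ### Specialization order, monotone convergence and well-filteredness -/

section Specialization

variable {X : Type u} [TopologicalSpace X]

theorem specLE_iff_specializes {x y : X} : SpecLE x y ↔ y ⤳ x :=
  specializes_iff_mem_closure.symm

theorem SpecLE.refl (x : X) : SpecLE x x :=
  subset_closure rfl

theorem SpecLE.trans {x y z : X} (hxy : SpecLE x y) (hyz : SpecLE y z) : SpecLE x z := by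
  rw [specLE_iff_specializes] at *
  exact hyz.trans hxy

theorem SpecLE.mem_closed {x y : X} (h : SpecLE x y) {C : Set X} (hC : IsClosed C) (hy : y ∈ C) :
    x ∈ C :=
  (specLE_iff_specializes.1 h).mem_closed hC hy

theorem SpecLE.mem_open {x y : X} (h : SpecLE x y) {U : Set X} (hU : IsOpen U) (hx : x ∈ U) :
    y ∈ U :=
  (specLE_iff_specializes.1 h).mem_open hU hx

theorem SpecLE.antisymm [T0Space X] {x y : X} (hxy : SpecLE x y) (hyx : SpecLE y x) : x = y :=
  ((specLE_iff_specializes.1 hyx).antisymm (specLE_iff_specializes.1 hxy)).eq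

theorem SpecLE.map {Y : Type v} [TopologicalSpace Y] {f : X → Y} (hf : Continuous f) {x y : X}
    (h : SpecLE x y) : SpecLE (f x) (f y) :=
  specLE_iff_specializes.2 ((specLE_iff_specializes.1 h).map hf)

theorem eq_of_closure_singleton_eq [T0Space X] {x y : X}
    (h : closure ({x} : Set X) = closure {y}) : x = y :=
  SpecLE.antisymm (h.subset (SpecLE.refl x)) (h.superset (SpecLE.refl y))

theorem IsDirectedSet.image {Y : Type v} [TopologicalSpace Y] {f : X → Y} (hf : Continuous f)
    {D : Set X} (hD : IsDirectedSet D) : IsDirectedSet (f '' D) := by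
  refine ⟨hD.1.image f, ?_⟩
  rintro _ ⟨a, ha, rfl⟩ _ ⟨b, hb, rfl⟩
  obtain ⟨c, hc, hac, hbc⟩ := hD.2 a ha b hb
  exact ⟨f c, ⟨c, hc, rfl⟩, hac.map hf, hbc.map hf⟩

theorem isSup_of_closure_eq {D : Set X} {s : X} (h : closure D = closure {s}) : IsSup D s := by
  refine ⟨fun d hd => h.subset (subset_closure hd), fun t ht => ?_⟩
  have : closure D ⊆ closure {t} := closure_minimal ht isClosed_closure
  exact this (h.superset (SpecLE.refl s))

theorem isCompactSaturated_nhdsKer {A : Set X} (hA : IsCompact A) :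
    IsCompactSaturated (nhdsKer A) := by
  refine ⟨hA.nhdsKer, ?_⟩
  rw [IsSaturated, ← nhdsKer_def, nhdsKer_nhdsKer]

theorem mem_nhdsKer_iff_specLE {A : Set X} {x : X} : x ∈ nhdsKer A ↔ ∃ a ∈ A, SpecLE a x := by
  simp only [mem_nhdsKer_iff_specializes, specLE_iff_specializes]

theorem IsCompactSaturated.mem_of_specLE {K : Set X} (hK : IsCompactSaturated K) {x y : X}
    (h : SpecLE x y) (hx : x ∈ K) : y ∈ K := by
  rw [hK.2, mem_sInter] at hx ⊢
  exact fun U hU => h.mem_open hU.1 (hx U hU)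

/-- In a well-filtered space, a closed set meeting every member of a filtered family of compact
saturated sets meets the intersection of the family. -/
theorem IsWellFiltered.nonempty_inter_sInter (hX : IsWellFiltered X) {𝒦 : Set (Set X)}
    (h𝒦 : IsFilteredFamily 𝒦) {C : Set X} (hC : IsClosed C) (hm : ∀ K ∈ 𝒦, (C ∩ K).Nonempty) :
    (C ∩ ⋂₀ 𝒦).Nonempty := by
  by_contra hne
  obtain ⟨K, hK, hKC⟩ := hX.2 𝒦 h𝒦 Cᶜ hC.isOpen_compl fun x hx hxC => hne ⟨x, hxC, hx⟩
  obtain ⟨x, hxC, hxK⟩ := hm K hK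
  exact hKC hxK hxC

/-- The principal upper sets of the members of `D` form a filtered family; a point of `closure D`
lying in all of them is above all of `D`, hence generic. -/
theorem IsWellFiltered.isMonotoneConvergence (hX : IsWellFiltered X) :
    IsMonotoneConvergence X := by
  have := hX.1
  refine ⟨hX.1, fun D hD => ?_⟩
  have hfam : IsFilteredFamily ((fun d => nhdsKer ({d} : Set X)) '' D) := by
    refine ⟨hD.1.image _, ?_, ?_⟩
    · rintro _ ⟨d, -, rfl⟩
      exact isCompactSaturated_nhdsKer isCompact_singleton
    · rintro _ ⟨a, ha, rfl⟩ _ ⟨b, hb, rfl⟩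
      obtain ⟨c, hc, hac, hbc⟩ := hD.2 a ha b hb
      refine ⟨_, ⟨c, hc, rfl⟩, fun x hx => ?_⟩
      simp only [mem_inter_iff, mem_nhdsKer_iff_specLE, mem_singleton_iff, exists_eq_left] at hx ⊢
      exact ⟨hac.trans hx, hbc.trans hx⟩
  obtain ⟨x, hxD, hx⟩ := hX.nonempty_inter_sInter hfam (isClosed_closure (s := D)) (by
    rintro _ ⟨d, hd, rfl⟩
    exact ⟨d, subset_closure hd, subset_nhdsKer rfl⟩)
  have hcl : closure D = closure {x} := by
    refine (closure_minimal (fun d hd => ?_) isClosed_closure).antisymm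
      (closure_minimal (by simpa using hxD) isClosed_closure)
    obtain ⟨_, rfl, h⟩ := mem_nhdsKer_iff_specLE.1 (mem_sInter.1 hx _ ⟨d, hd, rfl⟩)
    exact h
  exact ⟨x, hcl, fun y hy => eq_of_closure_singleton_eq (hy.symm.trans hcl)⟩

theorem dClosure_subset {A C : Set X} (hC : IsDClosed C) (h : A ⊆ C) : dClosure A ⊆ C :=
  sInter_subset_of_mem ⟨hC, h⟩

/-- Open sets are upper sets and directed sets are nonempty. Consequently an open set containing the
image of a `D`-completion is the whole space. -/
theorem _root_.IsOpen.isDClosed {U : Set X} (hU : IsOpen U) : IsDClosed U := by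
  rintro D hDU ⟨⟨d, hd⟩, -⟩ s hs
  exact (hs.1 d hd).mem_open hU (hDU hd)

/-- Sober `T₀` spaces are well-filtered. -/
theorem isWellFiltered_of_quasiSober [T0Space X] [QuasiSober X] : IsWellFiltered X := by
  refine ⟨inferInstance, fun 𝒦 h𝒦 U hU hsub => ?_⟩
  by_contra! hcon
  -- Compactness lets Zorn's lemma produce a minimal closed set in `Uᶜ` meeting every `K`. It is
  -- irreducible, and its generic point lies in every `K`, hence in `U`.
  obtain ⟨C, hCU, hC⟩ := zorn_superset_nonempty
    {C : Set X | IsClosed C ∧ ∀ K ∈ 𝒦, (C ∩ K).Nonempty} (by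
      intro c hc hchain hne
      refine ⟨⋂₀ c, ⟨isClosed_sInter fun s hs => (hc hs).1, fun K hK => ?_⟩,
        fun s hs => sInter_subset_of_mem hs⟩
      have : Nonempty c := hne.to_subtype
      by_contra hemp
      obtain ⟨⟨s, hs⟩, hs'⟩ := (h𝒦.2.1 K hK).1.elim_directed_family_closed
        (fun s : c => (s : Set X)) (fun s => (hc s.2).1)
        (by rw [← sInter_eq_iInter, inter_comm]; exact not_nonempty_iff_eq_empty.1 hemp)
        (DirectedOn.directed_val (IsChain.directedOn hchain.symm))
      obtain ⟨x, hx⟩ := (hc hs).2 K hK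
      exact (hs'.subset ⟨hx.2, hx.1⟩ : x ∈ (∅ : Set X)))
    Uᶜ ⟨hU.isClosed_compl, fun K hK => by
      obtain ⟨x, hx, hxU⟩ := not_subset.1 (hcon K hK)
      exact ⟨x, hxU, hx⟩⟩
  have hirr : IsIrreducible C := by
    obtain ⟨K₀, hK₀⟩ := h𝒦.1
    refine ⟨(hC.1.2 K₀ hK₀).mono inter_subset_left,
      isPreirreducible_iff_isClosed_union_isClosed.2 fun A B hA hB hAB => ?_⟩
    by_contra! hnot
    -- By minimality a proper closed part of `C` misses some `K`; filteredness then gives one `K`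
    -- missed by both parts.
    have key : ∀ A : Set X, IsClosed A → ¬ C ⊆ A → ∃ K ∈ 𝒦, ¬ (C ∩ A ∩ K).Nonempty := by
      intro A hA hCA
      by_contra! hall
      exact hCA ((hC.2 ⟨hC.1.1.inter hA, hall⟩ inter_subset_left).trans inter_subset_right)
    obtain ⟨K₁, hK₁, h₁⟩ := key A hA hnot.1
    obtain ⟨K₂, hK₂, h₂⟩ := key B hB hnot.2
    obtain ⟨K, hK, hKs⟩ := h𝒦.2.2 K₁ hK₁ K₂ hK₂
    obtain ⟨x, hxC, hxK⟩ := hC.1.2 K hK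
    rcases hAB hxC with hx | hx
    · exact h₁ ⟨x, ⟨hxC, hx⟩, (hKs hxK).1⟩
    · exact h₂ ⟨x, ⟨hxC, hx⟩, (hKs hxK).2⟩
  obtain ⟨x, hx⟩ := QuasiSober.sober hirr hC.1.1
  have hxC : x ∈ C := hx.mem
  refine hCU hxC (hsub (mem_sInter.2 fun K hK => ?_))
  obtain ⟨y, hyC, hyK⟩ := hC.1.2 K hK
  exact (h𝒦.2.1 K hK).mem_of_specLE (hx.def.superset hyC : SpecLE y x) hyK

theorem IsWellFiltered.of_homeomorph {Y : Type v} [TopologicalSpace Y] (hX : IsWellFiltered X)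
    (e : Y ≃ₜ X) : IsWellFiltered Y := by
  have := hX.1
  have himg : ∀ K : Set Y, IsCompactSaturated K → IsCompactSaturated (e '' K) := by
    intro K hK
    have hker : nhdsKer (e '' K) = e '' K := by
      refine Subset.antisymm (fun x hx => ?_) subset_nhdsKer
      obtain ⟨_, ⟨y, hy, rfl⟩, hyx⟩ := mem_nhdsKer_iff_specLE.1 hx
      refine ⟨e.symm x, hK.mem_of_specLE ?_ hy, e.apply_symm_apply x⟩
      simpa using hyx.map e.symm.continuous
    rw [← hker]
    exact isCompactSaturated_nhdsKer (hK.1.image e.continuous)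
  refine ⟨e.isEmbedding.t0Space, fun 𝒦 h𝒦 U hU hsub => ?_⟩
  have hfam : IsFilteredFamily ((fun K : Set Y => e '' K) '' 𝒦) := by
    refine ⟨h𝒦.1.image _, ?_, ?_⟩
    · rintro _ ⟨K, hK, rfl⟩
      exact himg K (h𝒦.2.1 K hK)
    · rintro _ ⟨K₁, h₁, rfl⟩ _ ⟨K₂, h₂, rfl⟩
      obtain ⟨K, hK, hKs⟩ := h𝒦.2.2 K₁ h₁ K₂ h₂
      exact ⟨_, ⟨K, hK, rfl⟩, subset_inter (image_mono (hKs.trans inter_subset_left))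
        (image_mono (hKs.trans inter_subset_right))⟩
  obtain ⟨_, ⟨K, hK, rfl⟩, hKU⟩ := hX.2 _ hfam (e '' U) (e.isOpenMap U hU) (by
    intro x hx
    refine ⟨e.symm x, hsub (mem_sInter.2 fun K hK => ?_), e.apply_symm_apply x⟩
    obtain ⟨y, hy, rfl⟩ := mem_sInter.1 hx _ ⟨K, hK, rfl⟩
    simpa using hy)
  exact ⟨K, hK, (image_subset_image_iff e.injective).1 hKU⟩

end Specialization

end NonHausdorff

namespace NonHausdorff

open Set

/-! ### Spaces of irreducible closed sets -/

section HitSpace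

/-- The irreducible closed subsets of `X` that satisfy `P`. -/
def HitSpace {X : Type u} [TopologicalSpace X] (P : Set X → Prop) : Type (max u v) :=
  ULift.{v} {C : Set X // IsClosed C ∧ IsIrreducible C ∧ P C}

namespace HitSpace

variable {X : Type u} [TopologicalSpace X] {P : Set X → Prop}

/-- The closed set underlying a point of a hit space. -/
def carrier (C : HitSpace.{u, v} P) : Set X := C.down.1

theorem isClosed (C : HitSpace.{u, v} P) : IsClosed C.carrier := C.down.2.1

theorem isIrreducible (C : HitSpace.{u, v} P) : IsIrreducible C.carrier := C.down.2.2.1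

theorem property (C : HitSpace.{u, v} P) : P C.carrier := C.down.2.2.2

theorem carrier_injective : Function.Injective (carrier : HitSpace.{u, v} P → Set X) :=
  fun _ _ h => ULift.down_injective (Subtype.ext h)

/-- The set of the points of a hit space that meet `U`. -/
def hit (U : Set X) : Set (HitSpace.{u, v} P) := {C | (C.carrier ∩ U).Nonempty}

/-- The topology whose open sets are the sets `hit U`, for `U` open. -/
instance : TopologicalSpace (HitSpace.{u, v} P) where
  IsOpen S := ∃ U : Set X, IsOpen U ∧ hit U = S
  isOpen_univ := ⟨univ, isOpen_univ, eq_univ_of_forall fun C => by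
    simpa [hit] using C.isIrreducible.1⟩
  isOpen_inter := by
    rintro _ _ ⟨U, hU, rfl⟩ ⟨V, hV, rfl⟩
    refine ⟨U ∩ V, hU.inter hV, ?_⟩
    ext C
    exact ⟨fun ⟨x, hx, hxU, hxV⟩ => ⟨⟨x, hx, hxU⟩, ⟨x, hx, hxV⟩⟩,
      fun h => C.isIrreducible.2 U V hU hV h.1 h.2⟩
  isOpen_sUnion S hS := by
    refine ⟨⋃₀ {U | IsOpen U ∧ hit U ∈ S}, isOpen_sUnion fun U hU => hU.1, ?_⟩
    ext C
    constructor
    · rintro ⟨x, hx, U, hU, hxU⟩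
      exact ⟨_, hU.2, x, hx, hxU⟩
    · rintro ⟨T, hT, hC⟩
      obtain ⟨U, hU, rfl⟩ := hS T hT
      obtain ⟨x, hx, hxU⟩ := hC
      exact ⟨x, hx, U, ⟨hU, hT⟩, hxU⟩

theorem isOpen_hit {U : Set X} (hU : IsOpen U) : IsOpen (hit U : Set (HitSpace.{u, v} P)) :=
  ⟨U, hU, rfl⟩

theorem exists_hit_eq {S : Set (HitSpace.{u, v} P)} (hS : IsOpen S) :
    ∃ U : Set X, IsOpen U ∧ hit U = S := hS

theorem specLE_iff {C D : HitSpace.{u, v} P} : SpecLE C D ↔ C.carrier ⊆ D.carrier := by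
  rw [specLE_iff_specializes, specializes_iff_forall_open]
  constructor
  · intro h x hx
    by_contra hxD
    obtain ⟨y, hy, hyD⟩ := h _ (isOpen_hit D.isClosed.isOpen_compl) ⟨x, hx, hxD⟩
    exact hyD hy
  · intro h S hS hC
    obtain ⟨U, -, rfl⟩ := exists_hit_eq hS
    exact hC.mono (inter_subset_inter_left _ h)

instance : T0Space (HitSpace.{u, v} P) :=
  ⟨fun _ _ h => carrier_injective ((specLE_iff.1 (specLE_iff_specializes.2 h.specializes')).antisymm
    (specLE_iff.1 (specLE_iff_specializes.2 h.specializes)))⟩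

section Unit

variable (hP : ∀ x : X, P (closure {x}))

/-- The canonical map of a space to a hit space. -/
def unit (x : X) : HitSpace.{u, v} P :=
  ⟨⟨closure {x}, isClosed_closure, isIrreducible_singleton.closure, hP x⟩⟩

theorem carrier_unit (x : X) : (unit.{u, v} hP x).carrier = closure {x} := rfl

theorem unit_mem_hit {U : Set X} (hU : IsOpen U) {x : X} : unit.{u, v} hP x ∈ hit U ↔ x ∈ U := by
  constructor
  · rintro ⟨y, hy, hyU⟩
    exact SpecLE.mem_open hy hU hyU
  · exact fun h => ⟨x, subset_closure rfl, h⟩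

theorem preimage_unit_hit {U : Set X} (hU : IsOpen U) : unit.{u, v} hP ⁻¹' hit U = U :=
  ext fun _ => unit_mem_hit hP hU

theorem continuous_unit : Continuous (unit.{u, v} hP) := by
  refine ⟨fun S hS => ?_⟩
  obtain ⟨U, hU, rfl⟩ := exists_hit_eq hS
  rwa [preimage_unit_hit hP hU]

theorem isEmbedding_unit [T0Space X] : IsEmbedding (unit.{u, v} hP) := by
  refine ⟨⟨le_antisymm (continuous_unit hP).le_induced fun U hU => ?_⟩, fun x y h => ?_⟩
  · exact ⟨hit U, isOpen_hit hU, preimage_unit_hit hP hU⟩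
  · exact eq_of_closure_singleton_eq (congrArg carrier h)

theorem closure_image_unit (C : HitSpace.{u, v} P) :
    closure (unit hP '' C.carrier) = closure {C} := by
  refine (closure_minimal ?_ isClosed_closure).antisymm (closure_minimal ?_ isClosed_closure)
  · rintro _ ⟨x, hx, rfl⟩
    exact specLE_iff.2 (closure_minimal (singleton_subset_iff.2 hx) C.isClosed)
  · rintro _ rfl
    rw [mem_closure_iff]
    intro S hS hC
    obtain ⟨U, hU, rfl⟩ := exists_hit_eq hS
    obtain ⟨x, hx, hxU⟩ := hC
    exact ⟨unit hP x, (unit_mem_hit hP hU).2 hxU, x, hx, rfl⟩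

/-- If the members of `P` are directed and `P` is closed under directed unions, the hit space of
`P` is a `D`-completion. -/
theorem isDCompletion_unit [T0Space X] (hdir : ∀ C : HitSpace.{u, v} P, IsDirectedSet C.carrier)
    (hsup : ∀ 𝒟 : Set (HitSpace.{u, v} P), IsDirectedSet 𝒟 →
      ∃ E : HitSpace.{u, v} P, E.carrier = ⋃ C ∈ 𝒟, C.carrier) :
    IsDCompletion (unit.{u, v} hP) := by
  refine ⟨⟨inferInstance, fun 𝒟 h𝒟 => ?_⟩, isEmbedding_unit hP, ?_⟩
  · obtain ⟨E, hE⟩ := hsup 𝒟 h𝒟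
    have hcl : closure 𝒟 = closure {E} := by
      refine (closure_minimal (fun C hC => specLE_iff.2 ?_) isClosed_closure).antisymm
        (closure_minimal ?_ isClosed_closure)
      · rw [hE]
        exact subset_biUnion_of_mem hC
      · rintro _ rfl
        rw [mem_closure_iff]
        intro S hS hES
        obtain ⟨U, hU, rfl⟩ := exists_hit_eq hS
        obtain ⟨x, hx, hxU⟩ := hES
        obtain ⟨C, hC, hxC⟩ := mem_iUnion₂.1 (hE ▸ hx)
        exact ⟨C, ⟨x, hxC, hxU⟩, hC⟩
    exact ⟨E, hcl, fun F hF => eq_of_closure_singleton_eq (hF.symm.trans hcl)⟩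
  · refine eq_univ_of_forall fun C => mem_sInter.2 fun A hA => ?_
    exact hA.1 (unit hP '' C.carrier) ((image_subset_range _ _).trans hA.2)
      ((hdir C).image (continuous_unit hP)) C (isSup_of_closure_eq (closure_image_unit hP C))

/-- If the closed image of every member of `P` under a continuous map is a point closure, the map
factors uniquely through the hit space of `P`. -/
theorem existsUnique_factor {T : Type*} [TopologicalSpace T] [T0Space T] {f : X → T}
    (hf : Continuous f)
    (h : ∀ C : HitSpace.{u, v} P, ∃ t : T, closure (f '' C.carrier) = closure {t}) :
    ∃! g : HitSpace.{u, v} P → T, Continuous g ∧ g ∘ unit hP = f := by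
  choose g hg using h
  refine ⟨g, ⟨⟨fun V hV => ⟨f ⁻¹' V, hV.preimage hf, ?_⟩⟩, ?_⟩, ?_⟩
  · ext C
    have h₁ : (closure (f '' C.carrier) ∩ V).Nonempty ↔ C ∈ hit (f ⁻¹' V) := by
      rw [closure_inter_open_nonempty_iff hV, image_inter_nonempty_iff]; rfl
    rw [← h₁, hg C, closure_inter_open_nonempty_iff hV, singleton_inter_nonempty]
    rfl
  · ext x
    refine eq_of_closure_singleton_eq ?_
    rw [Function.comp_apply, ← hg, carrier_unit, closure_image_closure hf, image_singleton]
  · rintro g' ⟨hg', rfl⟩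
    ext C
    refine eq_of_closure_singleton_eq ?_
    rw [← hg, image_comp, ← closure_image_closure hg', closure_image_unit,
      closure_image_closure hg', image_singleton]

end Unit

/-- The hit space of all irreducible closed sets is sober. -/
instance : QuasiSober (HitSpace.{u, v} fun _ : Set X => True) where
  sober {S} hS hSc := by
    -- `S` consists of the irreducible closed sets inside `Uᶜ`; irreducibility passes from `S` to
    -- `Uᶜ`, which is then the generic point.
    obtain ⟨U, hU, hUS⟩ := exists_hit_eq hSc.isOpen_compl
    have hmem : ∀ C : HitSpace.{u, v} fun _ : Set X => True, C ∈ S ↔ C.carrier ⊆ Uᶜ := by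
      intro C
      rw [← not_iff_not, ← mem_compl_iff, ← hUS, ← inter_compl_nonempty_iff, compl_compl]
      rfl
    have hP : ∀ x : X, (fun _ : Set X => True) (closure {x}) := fun _ => trivial
    have hunit : ∀ x : X, unit.{u, v} hP x ∈ S ↔ x ∈ Uᶜ := by
      intro x
      rw [hmem, carrier_unit, hU.isClosed_compl.closure_subset_iff, singleton_subset_iff]
    have hirr : IsIrreducible Uᶜ := by
      obtain ⟨C, hC⟩ := hS.1
      refine ⟨C.isIrreducible.1.mono ((hmem C).1 hC), ?_⟩
      rintro V W hV hW ⟨x, hx, hxV⟩ ⟨y, hy, hyW⟩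
      obtain ⟨D, hD, hDV, hDW⟩ := hS.2 (hit V) (hit W) (isOpen_hit hV) (isOpen_hit hW)
        ⟨_, (hunit x).2 hx, (unit_mem_hit hP hV).2 hxV⟩
        ⟨_, (hunit y).2 hy, (unit_mem_hit hP hW).2 hyW⟩
      exact (D.isIrreducible.2 V W hV hW hDV hDW).mono
        (inter_subset_inter_left _ ((hmem D).1 hD))
    refine ⟨⟨⟨Uᶜ, hU.isClosed_compl, hirr, trivial⟩⟩, ext fun C => ?_⟩
    rw [hmem]
    exact specLE_iff

/-- The hit space of all irreducible closed sets is a well-filterification if every irreducible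
closed set is mapped to a point closure in each well-filtered space. -/
theorem isWellFilterification_unit
    (h : ∀ (T : Type (max u v)) [TopologicalSpace T], IsWellFiltered T → ∀ f : X → T,
      Continuous f → ∀ C : Set X, IsClosed C → IsIrreducible C →
        ∃ t : T, closure (f '' C) = closure {t}) :
    IsWellFilterification (unit.{u, v} (P := fun _ : Set X => True) fun _ => trivial) := by
  refine ⟨isWellFiltered_of_quasiSober, continuous_unit _, fun T _ hT f hf => ?_⟩
  have := hT.1
  exact existsUnique_factor _ hf fun C => h T hT f hf _ C.isClosed C.isIrreducible

end HitSpace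

end HitSpace

end NonHausdorff

namespace NonHausdorff

open Set

/-! ### Closed, irreducible and compact subsets of `Z` -/

section Z

theorem _root_.IsLUB.mem_nat {d : Set ℕ} {a : ℕ} (ha : IsLUB d a) (hd : d.Nonempty) : a ∈ d :=
  ha.csSup_eq hd ▸ Nat.sSup_mem hd ha.bddAbove

/-- A supremum of a nonempty set of naturals is attained, so inaccessibility by directed suprema is
automatic. -/
theorem isOpen_withScott_nat_iff {s : Set (WithScott ℕ)} : IsOpen s ↔ IsUpperSet s := by
  rw [IsScott.isOpen_iff_isUpperSet_and_dirSupInaccOn (D := univ), and_iff_left_iff_imp]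
  intro _ d _ hne _ a ha has
  exact ⟨a, IsLUB.mem_nat (d := d) ha hne, has⟩

namespace Z

/-- The base set of the Ershov sum `Z`. -/
abbrev Base : Type := CofiniteTopology ℕ

instance : Infinite Base := Infinite.of_injective _ (CofiniteTopology.of (X := ℕ)).injective

theorem isOpen_iff {U : Set Z} :
    IsOpen U ↔ (∀ n, IsUpperSet (ErshovSum.section_ U n)) ∧ IsOpen (ErshovSum.support U) :=
  and_congr_left fun _ => forall_congr' fun _ => isOpen_withScott_nat_iff

theorem isClosed_iff {C : Set Z} :
    IsClosed C ↔ (∀ n, IsLowerSet (ErshovSum.section_ C n)) ∧ IsOpen (ErshovSum.support Cᶜ) := by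
  rw [← isOpen_compl_iff, isOpen_iff]
  refine and_congr_left fun _ => forall_congr' fun n => ?_
  exact isUpperSet_compl (s := ErshovSum.section_ C n)

/-- The complement meets every column outside the finite support of `C`. -/
theorem isClosed_of_finite {C : Set Z} (hC : ∀ n, IsLowerSet (ErshovSum.section_ C n))
    (hfin : (ErshovSum.support C).Finite) : IsClosed C := by
  refine isClosed_iff.2 ⟨hC, CofiniteTopology.isOpen_iff.2 fun _ => hfin.subset fun n hn => ?_⟩
  by_contra h
  exact hn ⟨WithScott.toScott 0, fun h0 => h ⟨_, h0⟩⟩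

/-- The column over `n`. -/
def column (n : Base) : Set Z := {z | z.base = n}

theorem support_subset_of_subset_column {C : Set Z} {n : Base} (h : C ⊆ column n) :
    ErshovSum.support C ⊆ {n} :=
  fun _ ⟨_, hy⟩ => h hy

theorem isClosed_column (n : Base) : IsClosed (column n) :=
  isClosed_of_finite (fun _ _ _ _ h => h)
    ((finite_singleton n).subset (support_subset_of_subset_column Subset.rfl))

theorem base_eq_of_specLE {z w : Z} (h : SpecLE z w) : z.base = w.base :=
  h.mem_closed (isClosed_column w.base) rfl

theorem specLE_mk_iff {n : Base} {a b : WithScott ℕ} : SpecLE (⟨n, a⟩ : Z) ⟨n, b⟩ ↔ a ≤ b := by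
  constructor
  · intro h
    have hcl : IsClosed {z : Z | z.base = n ∧ z.fiber ≤ b} :=
      isClosed_of_finite (fun _ _ _ hxy hx => ⟨hx.1, hxy.trans hx.2⟩)
        ((finite_singleton n).subset (support_subset_of_subset_column fun _ hz => hz.1))
    exact (h.mem_closed hcl ⟨rfl, le_rfl⟩).2
  · exact fun h => (isClosed_iff.1 isClosed_closure).1 n h (SpecLE.refl _)

instance : T0Space Z where
  t0 := by
    rintro ⟨n, a⟩ ⟨m, b⟩ h
    have h₁ := specLE_iff_specializes.2 h.specializes'
    have h₂ := specLE_iff_specializes.2 h.specializes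
    obtain rfl : n = m := base_eq_of_specLE h₁
    rw [specLE_mk_iff] at h₁ h₂
    rw [show a = b from Nat.le_antisymm h₁ h₂]

theorem specLE_total {z w : Z} (h : z.base = w.base) : SpecLE z w ∨ SpecLE w z := by
  obtain ⟨n, a⟩ := z
  obtain ⟨m, b⟩ := w
  obtain rfl : n = m := h
  rw [specLE_mk_iff, specLE_mk_iff]
  exact Nat.le_total a b

theorem isDirectedSet_of_subset_column {D : Set Z} (hD : D.Nonempty) {n : Base}
    (h : D ⊆ column n) : IsDirectedSet D := by
  refine ⟨hD, fun z hz w hw => ?_⟩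
  rcases specLE_total ((h hz).trans (h hw).symm) with hzw | hwz
  · exact ⟨w, hw, hzw, SpecLE.refl w⟩
  · exact ⟨z, hz, SpecLE.refl z, hwz⟩

theorem isDirectedSet_column (n : Base) : IsDirectedSet (column n) :=
  isDirectedSet_of_subset_column ⟨⟨n, WithScott.toScott 0⟩, rfl⟩ Subset.rfl

theorem eq_univ_of_infinite {C : Set Z} (hC : IsClosed C) (h : {n | column n ⊆ C}.Infinite) :
    C = univ := by
  by_contra hne
  refine h (((CofiniteTopology.isOpen_iff.1 (isClosed_iff.1 hC).2) ?_).subset ?_)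
  · obtain ⟨z, hz⟩ := (ne_univ_iff_exists_notMem C).1 hne
    exact ⟨z.base, z.fiber, hz⟩
  · rintro n hn ⟨y, hy⟩
    exact hy (hn rfl)

theorem isIrreducible_of_subset_column {D : Set Z} (hD : D.Nonempty) {n : Base}
    (h : D ⊆ column n) : IsIrreducible D := by
  refine ⟨hD, ?_⟩
  rintro U V hU hV ⟨x, hx, hxU⟩ ⟨y, hy, hyV⟩
  rcases specLE_total ((h hx).trans (h hy).symm) with hxy | hyx
  · exact ⟨y, hy, hxy.mem_open hU hxU, hyV⟩
  · exact ⟨x, hx, hxU, hyx.mem_open hV hyV⟩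

theorem eq_univ_or_subset_column {C : Set Z} (hC : IsClosed C) (hirr : IsIrreducible C) :
    C = univ ∨ ∃ n, C ⊆ column n := by
  by_cases hne : C = univ
  · exact Or.inl hne
  obtain ⟨z, hz⟩ := hirr.1
  -- Removing a column keeps a proper closed set closed, since the complement only grows and already
  -- meets cofinitely many columns.
  have hrest : IsClosed (C \ column z.base) := by
    refine isClosed_iff.2 ⟨fun n a b hba ha => ⟨(isClosed_iff.1 hC).1 n hba ha.1, ha.2⟩, ?_⟩
    refine CofiniteTopology.isOpen_iff.2 fun _ => ?_
    refine ((CofiniteTopology.isOpen_iff.1 (isClosed_iff.1 hC).2) ?_).subset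
      (compl_subset_compl.2 fun n ⟨y, hy⟩ => ⟨y, fun h => hy h.1⟩)
    obtain ⟨w, hw⟩ := (ne_univ_iff_exists_notMem C).1 hne
    exact ⟨w.base, w.fiber, hw⟩
  rcases isPreirreducible_iff_isClosed_union_isClosed.1 hirr.2 (column z.base) (C \ column z.base)
    (isClosed_column _) hrest (fun w hw => (em (w ∈ column z.base)).imp id fun h => ⟨hw, h⟩)
    with h | h
  · exact Or.inr ⟨_, h⟩
  · exact absurd rfl (h hz).2

/-- A compact set meets only finitely many columns. -/
theorem finite_support_of_isCompact {K : Set Z} (hK : IsCompact K) :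
    (ErshovSum.support K).Finite := by
  classical
  have hex : ∀ n, ∃ a, n ∈ ErshovSum.support K → (⟨n, a⟩ : Z) ∈ K := by
    intro n
    by_cases hn : n ∈ ErshovSum.support K
    · exact hn.imp fun _ h _ => h
    · exact ⟨WithScott.toScott 0, fun h => absurd h hn⟩
  choose a ha using hex
  -- These sets are open because they meet every column, strictly above the chosen point `a n`. Such
  -- a set contains `a n` itself only if `n ∈ F`.
  obtain ⟨F, hF⟩ := hK.elim_directed_cover
    (fun F : Finset Base => {z : Z | z.base ∈ F ∨ a z.base < z.fiber}) (fun F => by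
      refine isOpen_iff.2 ⟨fun n x y hxy hx => hx.imp id fun h => h.trans_le hxy, ?_⟩
      convert isOpen_univ
      exact eq_univ_of_forall fun n => ⟨Nat.succ (a n), Or.inr (Nat.lt_succ_self (a n))⟩)
    (fun z _ => mem_iUnion.2 ⟨{z.base}, Or.inl (Finset.mem_singleton_self _)⟩)
    (directed_of_isDirected_le fun F G hFG z hz => hz.imp (Finset.mem_of_subset hFG) id)
  refine F.finite_toSet.subset fun n hn => ?_
  exact (hF (ha n hn)).resolve_right (lt_irrefl _)

theorem isClosed_down_inter {A K : Set Z} (hA : IsClosed A) (hKF : IsKF A) :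
    IsClosed (down (K ∩ A)) := by
  obtain ⟨-, 𝒦, h𝒦, hmin⟩ := hKF
  rw [hA.closure_eq] at hmin
  obtain ⟨K₀, hK₀⟩ := h𝒦.1
  have hfin := finite_support_of_isCompact (h𝒦.2.1 K₀ hK₀).1
  have hsub : A ⊆ A ∩ {z | z.base ∈ ErshovSum.support K₀} := by
    refine hmin.2 ⟨hA.inter ?_, fun K hK => ?_⟩ inter_subset_left
    -- The part of `A` over the support of `K₀` is closed and, by filteredness, still meets every
    -- member of `𝒦`; minimality makes it all of `A`.
    · exact isClosed_of_finite (fun _ _ _ _ h => h) (hfin.subset fun _ ⟨_, hy⟩ => hy)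
    · obtain ⟨L, hL, hLs⟩ := h𝒦.2.2 K₀ hK₀ K hK
      obtain ⟨z, hzA, hzL⟩ := hmin.1.2 L hL
      exact ⟨z, ⟨hzA, z.fiber, (hLs hzL).1⟩, (hLs hzL).2⟩
  refine isClosed_of_finite ?_ (hfin.subset ?_)
  · rintro n x y hxy ⟨b, hb, hyb⟩
    exact ⟨b, hb, (specLE_mk_iff.2 hxy).trans hyb⟩
  · rintro n ⟨y, b, hb, hyb⟩
    have hn : n = b.base := base_eq_of_specLE hyb
    exact hn ▸ (hsub hb.2).2

/-! ### Maps out of `Z` and the two completions -/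

section Map

variable {T : Type u} [TopologicalSpace T] {f : Z → T} {s : Base → T}

/-- `s n` lies in an open `V` iff `f` sends some point of column `n` into `V`, so the preimage of
`V` under `s` is the support of an open set. -/
theorem continuous_of_closure_image_column (hf : Continuous f)
    (hs : ∀ n, closure (f '' column n) = closure {s n}) : Continuous s := by
  refine ⟨fun V hV => ?_⟩
  convert (isOpen_iff.1 (hV.preimage hf)).2 using 1
  ext n
  have h₁ : (closure (f '' column n) ∩ V).Nonempty ↔ n ∈ ErshovSum.support (f ⁻¹' V) := by
    rw [closure_inter_open_nonempty_iff hV, image_inter_nonempty_iff]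
    constructor
    · rintro ⟨z, rfl, hz⟩
      exact ⟨z.fiber, hz⟩
    · rintro ⟨y, hy⟩
      exact ⟨⟨n, y⟩, rfl, hy⟩
  rw [← h₁, hs n, closure_inter_open_nonempty_iff hV, singleton_inter_nonempty, mem_preimage]

/-- The saturations of the images of the cofinite sets under a continuous map defined on the base
form a filtered family. -/
theorem isFilteredFamily_cofinite (hs : Continuous s) :
    IsFilteredFamily {K : Set T | ∃ F : Set Base, F.Finite ∧ K = nhdsKer (s '' Fᶜ)} := by
  refine ⟨⟨_, ∅, finite_empty, rfl⟩, ?_, ?_⟩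
  · rintro _ ⟨F, -, rfl⟩
    -- The cofinite topology is Noetherian, so every subset of the base is compact.
    exact isCompactSaturated_nhdsKer ((TopologicalSpace.NoetherianSpace.isCompact _).image hs)
  · rintro _ ⟨F, hF, rfl⟩ _ ⟨G, hG, rfl⟩
    refine ⟨_, ⟨F ∪ G, hF.union hG, rfl⟩, subset_inter ?_ ?_⟩
    · exact nhdsKer_mono (image_mono (compl_subset_compl.2 subset_union_left))
    · exact nhdsKer_mono (image_mono (compl_subset_compl.2 subset_union_right))

end Map

theorem closure_image_eq_of_isWellFiltered {T : Type u} [TopologicalSpace T]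
    (hT : IsWellFiltered T) {f : Z → T} (hf : Continuous f) {C : Set Z} (hC : IsClosed C)
    (hirr : IsIrreducible C) : ∃ t : T, closure (f '' C) = closure {t} := by
  have hmc := hT.isMonotoneConvergence
  rcases eq_univ_or_subset_column hC hirr with rfl | ⟨n, hn⟩
  · choose s hs using fun n => (hmc.2 _ ((isDirectedSet_column n).image hf)).exists
    obtain ⟨t, htC, ht⟩ := hT.nonempty_inter_sInter
      (isFilteredFamily_cofinite (continuous_of_closure_image_column hf hs))
      (isClosed_closure (s := f '' univ)) (by
        rintro _ ⟨F, hF, rfl⟩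
        obtain ⟨n, hn⟩ := hF.infinite_compl.nonempty
        refine ⟨s n, ?_, subset_nhdsKer ⟨n, hn, rfl⟩⟩
        exact closure_mono (image_mono (subset_univ _)) ((hs n).superset (SpecLE.refl _)))
    refine ⟨t, (closure_minimal ?_ isClosed_closure).antisymm
      (closure_minimal (singleton_subset_iff.2 htC) isClosed_closure)⟩
    rw [image_subset_iff, univ_subset_iff]
    -- If only finitely many columns were mapped below `t`, taking them as `F` would put `t` above
    -- some `s n` with `n ∉ F`, a contradiction.
    refine eq_univ_of_infinite (isClosed_closure.preimage hf) fun hfin => ?_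
    obtain ⟨_, ⟨n, hn, rfl⟩, hnt⟩ := mem_nhdsKer_iff_specLE.1 (mem_sInter.1 ht _ ⟨_, hfin, rfl⟩)
    refine hn (image_subset_iff.1 (subset_closure.trans ((hs n).subset.trans ?_)))
    exact closure_minimal (singleton_subset_iff.2 hnt) isClosed_closure
  · exact (hmc.2 _ ((isDirectedSet_of_subset_column hirr.1 hn).image hf)).exists

theorem exists_isWellFilterification :
    ∃ (W : Type v) (_ : TopologicalSpace W) (η : Z → W), IsWellFilterification η :=
  ⟨HitSpace.{0, v} fun _ : Set Z => True, inferInstance, HitSpace.unit fun _ => trivial,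
    HitSpace.isWellFilterification_unit fun _ _ hT _ hf _ hC hirr =>
      closure_image_eq_of_isWellFiltered hT hf hC hirr⟩

/-- Irreducible closed sets inside a column are directed, and a directed family of them stays in one
column, so its union is again of this kind. -/
theorem exists_isDCompletion :
    ∃ (Y : Type u) (_ : TopologicalSpace Y) (j : Z → Y), IsDCompletion j := by
  refine ⟨HitSpace.{0, u} fun C : Set Z => ∃ n, C ⊆ column n, inferInstance,
    HitSpace.unit fun z => ⟨z.base, closure_minimal (singleton_subset_iff.2 rfl)
      (isClosed_column z.base)⟩, HitSpace.isDCompletion_unit _ (fun C => ?_) fun 𝒟 h𝒟 => ?_⟩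
  · obtain ⟨n, hn⟩ := C.property
    exact isDirectedSet_of_subset_column C.isIrreducible.1 hn
  · obtain ⟨C₀, hC₀⟩ := h𝒟.1
    obtain ⟨z, hz⟩ := C₀.isIrreducible.1
    have hsub : (⋃ C ∈ 𝒟, C.carrier) ⊆ column z.base := by
      refine iUnion₂_subset fun C hC => ?_
      obtain ⟨E, -, hE₀, hE⟩ := h𝒟.2 C₀ hC₀ C hC
      obtain ⟨n, hn⟩ := E.property
      have hzn : z.base = n := hn (HitSpace.specLE_iff.1 hE₀ hz)
      exact hzn ▸ (HitSpace.specLE_iff.1 hE).trans hn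
    have hclosed : IsClosed (⋃ C ∈ 𝒟, C.carrier) := by
      refine isClosed_of_finite (fun n x y hyx hx => ?_)
        ((finite_singleton _).subset (support_subset_of_subset_column hsub))
      obtain ⟨C, hC, hxC⟩ := mem_iUnion₂.1 hx
      exact mem_iUnion₂.2 ⟨C, hC, (isClosed_iff.1 C.isClosed).1 n hyx hxC⟩
    exact ⟨⟨⟨_, hclosed, isIrreducible_of_subset_column
      ⟨z, mem_iUnion₂.2 ⟨C₀, hC₀, hz⟩⟩ hsub, _, hsub⟩⟩, rfl⟩

theorem not_isWellFiltered_of_isDCompletion {Y : Type u} [TopologicalSpace Y] {j : Z → Y}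
    (hj : IsDCompletion j) : ¬ IsWellFiltered Y := by
  intro hY
  obtain ⟨hmc, hemb, hcl⟩ := hj
  choose s hs using fun n => (hmc.2 _ ((isDirectedSet_column n).image hemb.continuous)).exists
  -- For `n ≠ m`, the points not below both suprema form an open set containing the image of `Z`,
  -- hence all of `Y`.
  have hdisj : ∀ n m (y : Y), SpecLE y (s n) → SpecLE y (s m) → n = m := by
    intro n m y hn hm
    by_contra hnm
    have hopen : IsOpen (closure {s n} ∩ closure {s m})ᶜ :=
      (isClosed_closure.inter isClosed_closure).isOpen_compl
    have hrange : range j ⊆ (closure {s n} ∩ closure {s m})ᶜ := by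
      rintro _ ⟨z, rfl⟩ ⟨hzn, hzm⟩
      have hcol : ∀ k, j z ∈ closure {s k} → z ∈ column k := fun k hk => by
        rw [← hs k] at hk
        rw [← (isClosed_column k).closure_eq, hemb.closure_eq_preimage_closure_image]
        exact hk
      exact hnm ((hcol n hzn).symm.trans (hcol m hzm))
    exact dClosure_subset hopen.isDClosed hrange (hcl.superset (mem_univ y)) ⟨hn, hm⟩
  -- The points below some `s n` form a `d`-closed set: by `hdisj` all members of a directed set lie
  -- below the same `s n`.
  have hcover : ∀ y : Y, ∃ n, SpecLE y (s n) := by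
    intro y
    refine dClosure_subset (C := {y | ∃ n, SpecLE y (s n)}) ?_ ?_ (hcl.superset (mem_univ y))
    · intro D hD hdir t ht
      obtain ⟨d, hd⟩ := hdir.1
      obtain ⟨n, hn⟩ := hD hd
      refine ⟨n, ht.2 _ fun e he => ?_⟩
      obtain ⟨c, hc, hdc, hec⟩ := hdir.2 d hd e he
      obtain ⟨m, hm⟩ := hD hc
      rw [hdisj n m d hn (hdc.trans hm)]
      exact hec.trans hm
    · rintro _ ⟨z, rfl⟩
      exact ⟨z.base, (hs z.base).subset (subset_closure ⟨z, rfl, rfl⟩)⟩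
  obtain ⟨y, -, hy⟩ := hY.nonempty_inter_sInter
    (isFilteredFamily_cofinite (continuous_of_closure_image_column hemb.continuous hs))
    isClosed_univ (by
      rintro _ ⟨F, hF, rfl⟩
      obtain ⟨n, hn⟩ := hF.infinite_compl.nonempty
      exact ⟨s n, trivial, subset_nhdsKer ⟨n, hn, rfl⟩⟩)
  obtain ⟨n, hn⟩ := hcover y
  -- Omitting `n` from the base puts `y` above some `s m` with `m ≠ n`, so `s m` would lie below `s
  -- n`.
  obtain ⟨_, ⟨m, hm, rfl⟩, hmy⟩ :=
    mem_nhdsKer_iff_specLE.1 (mem_sInter.1 hy _ ⟨{n}, finite_singleton n, rfl⟩)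
  exact hm (hdisj m n (s m) (SpecLE.refl _) (hmy.trans hn))

end Z

end Z

end NonHausdorff

theorem mainTheorem8 :
    T0Space NonHausdorff.Z ∧
    (∀ A K : Set NonHausdorff.Z, IsClosed A → NonHausdorff.IsKF A →
      NonHausdorff.IsCompactSaturated K → IsClosed (NonHausdorff.down (K ∩ A))) ∧
    (∃ (Y : Type u) (_ : TopologicalSpace Y) (j : NonHausdorff.Z → Y),
      NonHausdorff.IsDCompletion j) ∧
    (∃ (W : Type v) (_ : TopologicalSpace W) (η : NonHausdorff.Z → W),
      NonHausdorff.IsWellFilterification η) ∧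
    (∀ (Y : Type u) (W : Type v) [TopologicalSpace Y] [TopologicalSpace W]
      (j : NonHausdorff.Z → Y) (η : NonHausdorff.Z → W),
      NonHausdorff.IsDCompletion j → NonHausdorff.IsWellFilterification η →
        IsEmpty (Y ≃ₜ W)) :=
  ⟨inferInstance, fun _ _ hA hKF _ => NonHausdorff.Z.isClosed_down_inter hA hKF,
    NonHausdorff.Z.exists_isDCompletion, NonHausdorff.Z.exists_isWellFilterification,
    fun _ _ _ _ _ _ hj hη =>
      ⟨fun e => NonHausdorff.Z.not_isWellFiltered_of_isDCompletion hj (hη.1.of_homeomorph e)⟩⟩
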